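/- Let $L$ be a countable relational language and let $\mathcal K$ be a class of finite $L$-structures which is a Fraïssé class: it is hereditary (if $A$ embeds into $B\in\mathcal K$ then $A\in\mathcal K$), has joint embedding (any $A,B\in\mathcal K$ both embed into some $C\in\mathcal K$), has amalgamation (for all $A,B_0,B_1\in\mathcal K$ and embeddings $a_i:A\to B_i$, $i\in\{0,1\}$, there are $C\in\mathcal K$ and embeddings $b_i:B_i\to C$ with $b_0\circ a_0=b_1\circ a_1$), and contains structures of size at least $n$ for every $n\in\mathbb N$. For structures $A,C$ write $\binom{C}{A}$ for the set of substructures of $C$ isomorphic to $A$, and $C^A$ for the set of embeddings of $A$ into $C$. For $k,d\in\mathbb N$ write $[k]=\{0,\dots,k-1\}$ and - $C\to(B)^A_{k,d}$ if for every $\chi:\binom{C}{A}\to[k]$ there is $B'\in\binom{C}{B}$ with $|\chi(\binom{B'}{A})|\le d$; - $C\hookrightarrow(B)^A_{k,d}$ if for every $\chi:C^A\to[k]$ there is $b\in C^B$ with $|\chi(\{b\circ a: a\in B^A\})|\le d$. The Ramsey degree (respectively, the Ramsey degree for embeddings) of $A\in\mathcal K$ in $\mathcal K$ is the least $d\in\mathbb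 N$ such that for all $B\in\mathcal K$ and $k\ge 2$ there is $C\in\mathcal K$ with $C\to(B)^A_{k,d}$ (respectively, $C\hookrightarrow(B)^A_{k,d}$), and it is $\infty$ if no such $d$ exists. The Ramsey degree (respectively, the Ramsey degree for embeddings) of $\mathcal K$ is the supremum over $A\in\mathcal K$ of these degrees. The class $\mathcal K$ is Ramsey if its Ramsey degree is $1$. **Theorem.** If $\mathcal K$ is Ramsey, then the Ramsey degree for embeddings of $\mathcal K$ is either $\infty$ or equal to $2^m$ for some $m\in\mathbb N$. -/

import Mathlib

open FirstOrder

universe u v w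

namespace FraisseRamsey

open FirstOrder.Language CategoryTheory



variable {L : FirstOrder.Language.{u, v}}

/-- A Fraïssé class: a class of finite structures that is hereditary, has joint embedding and
amalgamation, and contains structures of size at least `n` for every natural number `n`.
(No bound on the number of isomorphism types is imposed.) -/
structure IsFraisseClass (K : Set (Bundled.{w} L.Structure)) : Prop where
  finite : ∀ A ∈ K, Finite A
  hereditary : Hereditary K
  jointEmbedding : JointEmbedding K
  amalgamation : Amalgamation K
  unbounded : ∀ n : ℕ, ∃ A ∈ K, n ≤ Nat.card A

/-- `C choose A`: the set of substructures of `C` which are isomorphic to `A`. -/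
def copies (A C : Bundled.{w} L.Structure) : Set (L.Substructure C) :=
  {S | Nonempty (S ≃[L] A)}

/-- The partition relation `C → (B)^A_{k,d}`: for every colouring `χ` of `C choose A` with `k`
colours there is `B'` in `C choose B` such that `χ` takes at most `d` values on the substructures
of `B'` which are isomorphic to `A`. -/
def Arrow (C B A : Bundled.{w} L.Structure) (k d : ℕ) : Prop :=
  ∀ χ : copies A C → Fin k, ∃ B' ∈ copies B C,
    (χ '' {A' : copies A C | (A' : L.Substructure C) ≤ B'}).encard ≤ d

/-- The partition relation for embeddings `C ↪ (B)^A_{k,d}`: for every colouring `χ` of the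
embeddings of `A` into `C` with `k` colours there is an embedding `b` of `B` into `C` such that `χ`
takes at most `d` values on `{b ∘ a | a : A ↪ B}`. -/
def EmbArrow (C B A : Bundled.{w} L.Structure) (k d : ℕ) : Prop :=
  ∀ χ : (A ↪[L] C) → Fin k, ∃ b : B ↪[L] C,
    (χ '' Set.range (fun a : A ↪[L] B => b.comp a)).encard ≤ d

/-- The Ramsey degree of `A` in `K`: the least natural number `d` such that for all `B ∈ K` and
`k ≥ 2` there is `C ∈ K` with `C → (B)^A_{k,d}`, and `⊤` if there is no such `d`. -/
noncomputable def ramseyDegreeOf (K : Set (Bundled.{w} L.Structure))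
    (A : Bundled.{w} L.Structure) : ℕ∞ :=
  sInf ((fun d : ℕ => (d : ℕ∞)) ''
    {d : ℕ | ∀ B ∈ K, ∀ k : ℕ, 2 ≤ k → ∃ C ∈ K, Arrow C B A k d})

/-- The Ramsey degree of `K`: the supremum of the Ramsey degrees of its members. -/
noncomputable def ramseyDegree (K : Set (Bundled.{w} L.Structure)) : ℕ∞ :=
  ⨆ A ∈ K, ramseyDegreeOf K A

/-- `K` is Ramsey if its Ramsey degree is `1`. -/
def IsRamsey (K : Set (Bundled.{w} L.Structure)) : Prop :=
  ramseyDegree K = 1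

/-- The Ramsey degree for embeddings of `A` in `K`: the least natural number `d` such that for all
`B ∈ K` and `k ≥ 2` there is `C ∈ K` with `C ↪ (B)^A_{k,d}`, and `⊤` if there is no such `d`. -/
noncomputable def embRamseyDegreeOf (K : Set (Bundled.{w} L.Structure))
    (A : Bundled.{w} L.Structure) : ℕ∞ :=
  sInf ((fun d : ℕ => (d : ℕ∞)) ''
    {d : ℕ | ∀ B ∈ K, ∀ k : ℕ, 2 ≤ k → ∃ C ∈ K, EmbArrow C B A k d})

/-- The Ramsey degree for embeddings of `K`: the supremum of the Ramsey degrees for embeddings of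
its members. -/
noncomputable def embRamseyDegree (K : Set (Bundled.{w} L.Structure)) : ℕ∞ :=
  ⨆ A ∈ K, embRamseyDegreeOf K A

end FraisseRamsey

/-! In a Ramsey class the degree for embeddings of `A` is the order of its automorphism group:
embeddings with a given range form one free orbit of that group (`embRamseyDegreeOf_eq`). If the
supremum is finite, these orders are bounded, hence the supremum is attained. By Cauchy's theorem it
remains to exclude nontrivial automorphisms `s` of odd order (`eq_one_of_odd_order`). The Ramsey
property and the bound yield a linear order in which the comparison of `y` with `s y` either
persists or flips at every step along an orbit of `s`; on an odd cycle both are impossible unless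
`s` fixes the point. -/

namespace FraisseRamsey

open FirstOrder.Language CategoryTheory

/-! ### Automorphism groups and their action on embeddings. -/

section Automorphisms

variable {L : FirstOrder.Language.{u, v}}

/-- The automorphism group of a structure. -/
instance autGroup {M : Type w} [L.Structure M] : Group (M ≃[L] M) where
  mul f g := f.comp g
  one := FirstOrder.Language.Equiv.refl L M
  inv f := f.symm
  mul_assoc _ _ _ := rfl
  one_mul _ := rfl
  mul_one _ := rfl
  inv_mul_cancel f := FirstOrder.Language.Equiv.symm_comp_self f

theorem mul_apply {M : Type w} [L.Structure M] (f g : M ≃[L] M) (x : M) :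
    (f * g) x = f (g x) := rfl

theorem one_apply {M : Type w} [L.Structure M] (x : M) : (1 : M ≃[L] M) x = x := rfl

instance finite_equiv {M : Type w} [L.Structure M] [Finite M] : Finite (M ≃[L] M) :=
  Finite.of_injective (fun f : M ≃[L] M => (f : M → M)) DFunLike.coe_injective

instance finite_embedding {M N : Type w} [L.Structure M] [L.Structure N] [Finite M] [Finite N] :
    Finite (M ↪[L] N) :=
  Finite.of_injective (fun f : M ↪[L] N => (f : M → N)) DFunLike.coe_injective

theorem exists_equiv_of_range_eq {M N : Type w} [L.Structure M] [L.Structure N]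
    {e f : M ↪[L] N} (h : e.toHom.range = f.toHom.range) :
    ∃ t : M ≃[L] M, f = e.comp t.toEmbedding := by
  have key : ∀ S : L.Substructure N, f.toHom.range = S →
      ∃ t : M ≃[L] S, ∀ x, (t x : N) = f x := by
    rintro S rfl
    exact ⟨f.equivRange, f.equivRange_apply⟩
  obtain ⟨t, ht⟩ := key _ h.symm
  refine ⟨e.equivRange.symm.comp t, ?_⟩
  ext x
  have := e.equivRange_apply (e.equivRange.symm (t x))
  rw [FirstOrder.Language.Equiv.apply_symm_apply] at this
  rw [← ht x, this]
  rfl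

theorem range_comp_equiv {M N : Type w} [L.Structure M] [L.Structure N]
    (e : M ↪[L] N) (t : M ≃[L] M) :
    (e.comp t.toEmbedding).toHom.range = e.toHom.range := by
  ext y
  constructor
  · rintro ⟨x, rfl⟩
    exact ⟨t x, rfl⟩
  · rintro ⟨x, rfl⟩
    exact ⟨t.symm x, congrArg e (t.apply_symm_apply x)⟩

end Automorphisms

/-! ### The degree for embeddings as the order of the automorphism group. -/

section Degrees

variable {L : FirstOrder.Language.{u, v}} {K : Set (Bundled.{w} L.Structure)}

theorem IsRamsey.exists_arrow_one (hR : IsRamsey K) {A B : Bundled.{w} L.Structure} (hA : A ∈ K)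
    (hB : B ∈ K) {k : ℕ} (hk : 2 ≤ k) : ∃ C ∈ K, Arrow C B A k 1 := by
  have hle : ramseyDegreeOf K A ≤ 1 := by
    rw [← show ramseyDegree K = 1 from hR]
    exact le_iSup₂ (f := fun A (_ : A ∈ K) => ramseyDegreeOf K A) A hA
  have hne : ((fun d : ℕ => (d : ℕ∞)) ''
      {d : ℕ | ∀ B ∈ K, ∀ k : ℕ, 2 ≤ k → ∃ C ∈ K, Arrow C B A k d}).Nonempty := by
    rw [Set.nonempty_iff_ne_empty]
    intro h
    rw [ramseyDegreeOf, h, sInf_empty] at hle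
    exact absurd hle (by simp)
  obtain ⟨d, hd, hd'⟩ := csInf_mem hne
  have hd1 : (d : ℕ∞) ≤ 1 := hd'.le.trans hle
  obtain ⟨C, hC, h⟩ := hd B hB k hk
  refine ⟨C, hC, fun χ => ?_⟩
  obtain ⟨B', hB', hχ⟩ := h χ
  exact ⟨B', hB', hχ.trans (by exact_mod_cast hd1)⟩

/-- In a Ramsey class, colourings of substructures with finitely many colours become constant on the
copies of `A` in a suitable copy of `B`. -/
theorem IsRamsey.exists_monochromatic (hR : IsRamsey K) {A B : Bundled.{w} L.Structure}
    (hA : A ∈ K) (hB : B ∈ K) (κ : Type*) [Finite κ] :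
    ∃ C ∈ K, ∀ χ : L.Substructure C → κ, ∃ b : B ↪[L] C, ∀ e f : A ↪[L] B,
      χ (b.comp e).toHom.range = χ (b.comp f).toHom.range := by
  obtain ⟨n, ⟨i⟩⟩ := Finite.exists_equiv_fin κ
  -- Two spare colours, since the degree only concerns `k ≥ 2`.
  obtain ⟨C, hC, h⟩ := hR.exists_arrow_one hA hB (k := n + 2) (by omega)
  refine ⟨C, hC, fun χ => ?_⟩
  obtain ⟨B', ⟨φ⟩, hB'⟩ := h fun S => Fin.castAdd 2 (i (χ S))
  refine ⟨B'.subtype.comp φ.symm.toEmbedding, fun e f => ?_⟩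
  have hle (g : A ↪[L] B) :
      ((B'.subtype.comp φ.symm.toEmbedding).comp g).toHom.range ≤ B' := by
    rintro _ ⟨x, rfl⟩
    exact (φ.symm (g x)).2
  have hmem (g : A ↪[L] B) :
      ((B'.subtype.comp φ.symm.toEmbedding).comp g).toHom.range ∈ copies A C :=
    ⟨(Embedding.equivRange _).symm⟩
  have := Set.encard_le_one_iff.1 hB' _ _ ⟨⟨_, hmem e⟩, hle e, rfl⟩ ⟨⟨_, hmem f⟩, hle f, rfl⟩
  exact i.injective (Fin.castAdd_injective _ _ this)

theorem IsRamsey.exists_embArrow_card_aut (hR : IsRamsey K) {A B : Bundled.{w} L.Structure}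
    [Finite A] (hA : A ∈ K) (hB : B ∈ K) (k : ℕ) :
    ∃ C ∈ K, EmbArrow C B A k (Nat.card (A ≃[L] A)) := by
  obtain ⟨C, hC, h⟩ := hR.exists_monochromatic hA hB (Set (Fin k))
  refine ⟨C, hC, fun χ => ?_⟩
  -- A substructure is coloured by the set of colours of the embeddings onto it.
  obtain ⟨b, hb⟩ := h fun S => χ '' {e | e.toHom.range = S}
  refine ⟨b, ?_⟩
  rcases isEmpty_or_nonempty (A ↪[L] B) with hE | ⟨⟨e⟩⟩
  · rw [Set.range_eq_empty, Set.image_empty, Set.encard_empty]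
    exact zero_le
  have hsub : χ '' Set.range (fun a : A ↪[L] B => b.comp a) ⊆
      (fun t : A ≃[L] A => χ ((b.comp e).comp t.toEmbedding)) '' Set.univ := by
    rintro _ ⟨_, ⟨f, rfl⟩, rfl⟩
    have : χ (b.comp f) ∈ χ '' {g | g.toHom.range = (b.comp e).toHom.range} := by
      rw [hb e f]
      exact ⟨_, rfl, rfl⟩
    obtain ⟨g, hg, hgf⟩ := this
    obtain ⟨t, rfl⟩ := exists_equiv_of_range_eq (show (b.comp e).toHom.range = _ from hg.symm)
    exact ⟨t, trivial, hgf⟩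
  refine (Set.encard_le_encard hsub).trans ((Set.encard_image_le _ _).trans ?_)
  rw [Set.encard_univ, ENat.card_eq_coe_natCard]

/-- Every structure `C` has a colouring of the embeddings of `A` by automorphisms of `A` which is
equivariant for precomposition. -/
theorem exists_equivariant_colouring (A C : Bundled.{w} L.Structure) :
    ∃ c : (A ↪[L] C) → (A ≃[L] A), ∀ e t, c (e.comp t.toEmbedding) = c e * t := by
  classical
  rcases isEmpty_or_nonempty (A ↪[L] C) with hE | ⟨⟨e₀⟩⟩
  · exact ⟨fun _ => 1, fun e => (hE.false e).elim⟩
  -- One embedding is fixed for each range; `c e` will be the automorphism carrying it to `e`.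
  let rep : L.Substructure C → (A ↪[L] C) := fun S =>
    if h : ∃ e : A ↪[L] C, e.toHom.range = S then h.choose else e₀
  have hrep (e : A ↪[L] C) : (rep e.toHom.range).toHom.range = e.toHom.range := by
    have h : ∃ f : A ↪[L] C, f.toHom.range = e.toHom.range := ⟨e, rfl⟩
    simp only [rep, dif_pos h]
    exact h.choose_spec
  choose c hc using fun e : A ↪[L] C => exists_equiv_of_range_eq (hrep e)
  refine ⟨c, fun e t => ?_⟩
  have h₁ := hc (e.comp t.toEmbedding)
  rw [range_comp_equiv] at h₁
  have h₂ : (rep e.toHom.range).comp (c (e.comp t.toEmbedding)).toEmbedding =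
      (rep e.toHom.range).comp (c e * t).toEmbedding := by
    rw [← h₁]
    conv_lhs => rw [hc e]
    rfl
  have h₃ := Embedding.comp_injective _ h₂
  ext x
  exact congrArg (fun f : A ↪[L] A => f x) h₃

/-- With `B = A`, an equivariant colouring takes every value of a coset `c b * t`, for any choice of
`b`. -/
theorem card_aut_le_of_embArrow {A C : Bundled.{w} L.Structure} [Finite A] {k d : ℕ}
    (hk : Nat.card (A ≃[L] A) ≤ k) (h : EmbArrow C A A k d) : Nat.card (A ≃[L] A) ≤ d := by
  obtain ⟨c, hc⟩ := exists_equivariant_colouring A C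
  let i : (A ≃[L] A) → Fin k := fun t => Fin.castLE hk (Finite.equivFin _ t)
  have hi : Function.Injective i :=
    (Fin.castLE_injective hk).comp (Finite.equivFin _).injective
  obtain ⟨b, hb⟩ := h fun e => i (c e)
  have hsub : (fun t : A ≃[L] A => i (c b * t)) '' Set.univ ⊆
      (fun e => i (c e)) '' Set.range (fun a : A ↪[L] A => b.comp a) := by
    rintro _ ⟨t, -, rfl⟩
    exact ⟨_, ⟨t.toEmbedding, rfl⟩, congrArg i (hc b t)⟩
  have hle := (Set.encard_le_encard hsub).trans hb
  have hinj : Function.Injective fun t : A ≃[L] A => i (c b * t) :=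
    hi.comp (mul_right_injective (c b))
  rw [hinj.encard_image, Set.encard_univ,
    ENat.card_eq_coe_natCard] at hle
  exact_mod_cast hle

theorem IsRamsey.embRamseyDegreeOf_eq (hR : IsRamsey K) {A : Bundled.{w} L.Structure}
    [Finite A] (hA : A ∈ K) : embRamseyDegreeOf K A = Nat.card (A ≃[L] A) := by
  apply le_antisymm
  · exact sInf_le ⟨_, fun B hB k _ => hR.exists_embArrow_card_aut hA hB k, rfl⟩
  · apply le_sInf
    rintro _ ⟨d, hd, rfl⟩
    obtain ⟨C, -, h⟩ := hd A hA (Nat.card (A ≃[L] A) + 2) (by omega)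
    exact Nat.cast_le.2 (card_aut_le_of_embArrow (by omega) h)

end Degrees

/-! ### Automorphisms of odd order. -/

section OddOrder

variable {L : FirstOrder.Language.{u, v}} {K : Set (Bundled.{w} L.Structure)}

/-- Given finitely many pairs of embeddings of `B` into `D`, there is an extension of `D` in which
the two members of each pair differ by an embedding of `D`. -/
theorem IsFraisseClass.exists_extension (hK : IsFraisseClass K) {B D : Bundled.{w} L.Structure}
    (hB : B ∈ K) (hD : D ∈ K) {ι : Type*} (s : Finset ι) (j j' : ι → (B ↪[L] D)) :
    ∃ E ∈ K, ∃ i : D ↪[L] E, ∀ p ∈ s, ∃ f : D ↪[L] E, f.comp (j p) = i.comp (j' p) := by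
  classical
  induction s using Finset.induction_on with
  | empty => exact ⟨D, hD, Embedding.refl L D, by simp⟩
  | insert p s _ ih =>
    obtain ⟨E, hE, i, h⟩ := ih
    obtain ⟨Q, f, g, hQ, hfg⟩ := hK.amalgamation B D E (j p) (i.comp (j' p)) hB hD hE
    refine ⟨Q, hQ, g.comp i, fun q hq => ?_⟩
    rcases Finset.mem_insert.1 hq with rfl | hq
    · exact ⟨f, hfg⟩
    · obtain ⟨f', hf'⟩ := h q hq
      exact ⟨g.comp f', by rw [Embedding.comp_assoc, hf', Embedding.comp_assoc]⟩

/-- Members of a Ramsey class admit linear orders for which any two copies of `D` are isomorphic as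
ordered structures. The linear order is given by an injection into `ℕ`. -/
theorem IsRamsey.exists_homogeneous_order (hK : IsFraisseClass K) (hR : IsRamsey K)
    {D E : Bundled.{w} L.Structure} (hD : D ∈ K) (hE : E ∈ K) :
    ∃ g : E → ℕ, Function.Injective g ∧ ∀ f f' : D ↪[L] E, ∃ t : D ≃[L] D, ∀ x y,
      g (f x) < g (f y) ↔ g (f' (t x)) < g (f' (t y)) := by
  have := hK.finite D hD
  obtain ⟨C, hC, h⟩ := hR.exists_monochromatic hD hE (Set (D → D → Prop))
  have := hK.finite C hC
  obtain ⟨n, ⟨φ⟩⟩ := Finite.exists_equiv_fin C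
  let o : C → ℕ := fun x => φ x
  have ho : Function.Injective o := Fin.val_injective.comp φ.injective
  -- The colour of a copy of `D` is the set of all orders it induces on `D`.
  obtain ⟨b, hb⟩ := h fun S => {R | ∃ e : D ↪[L] C, e.toHom.range = S ∧
    R = fun x y => o (e x) < o (e y)}
  refine ⟨o ∘ b, ho.comp b.injective, fun f f' => ?_⟩
  have hmem : (fun x y => o (b (f x)) < o (b (f y))) ∈ {R : D → D → Prop | ∃ e : D ↪[L] C,
      e.toHom.range = (b.comp f').toHom.range ∧ R = fun x y => o (e x) < o (e y)} := by
    rw [← hb f f']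
    exact ⟨b.comp f, rfl, rfl⟩
  obtain ⟨e, he, hR⟩ := hmem
  obtain ⟨t, rfl⟩ := exists_equiv_of_range_eq he.symm
  exact ⟨t, fun x y => iff_of_eq (congrFun (congrFun hR x) y)⟩

/-- If `P` holds, the weights are strictly monotone along the orbit, which cannot close up;
otherwise they alternately rise and fall, which forces an even period. -/
theorem apply_eq_of_odd_of_uniform_comparison {M : Type*} {w : M → ℕ}
    (hw : Function.Injective w) {s : M → M} (hs : Function.Injective s) {x : M} {q : ℕ}
    (hq : Odd q) (hsq : s^[q] x = x) {P : Prop}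
    (hP : ∀ k, P ↔ (w (s (s^[k] x)) < w (s (s (s^[k] x))) ↔ w (s^[k] x) < w (s (s^[k] x)))) :
    s x = x := by
  by_contra hx
  set a : ℕ → ℕ := fun k => w (s^[k] x) with ha
  have hP' : ∀ k, P ↔ (a (k + 1) < a (k + 2) ↔ a k < a (k + 1)) := by
    intro k
    simp only [ha, Function.iterate_succ_apply']
    exact hP k
  have hne : ∀ k, a k ≠ a (k + 1) := by
    intro k h
    have h' := hw h
    rw [Function.iterate_succ_apply] at h'
    exact hx (hs.iterate k h').symm
  have haq : a q = a 0 := congrArg w hsq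
  have haq' : a (q + 1) = a 1 := by
    simp only [ha, Function.iterate_succ_apply', hsq, Function.iterate_zero, id]
  by_cases h : P
  · have hc : ∀ k, (a k < a (k + 1) ↔ a 0 < a 1) := by
      intro k
      induction k with
      | zero => rfl
      | succ k ih => exact ((hP' k).1 h).trans ih
    have hq0 : 0 < q := hq.pos
    by_cases h0 : a 0 < a 1
    · exact absurd haq (strictMono_nat_of_lt_succ (fun k => (hc k).2 h0) hq0).ne'
    · refine absurd haq (strictAnti_nat_of_succ_lt (fun k => ?_) hq0).ne
      exact lt_of_le_of_ne (not_lt.1 fun h1 => h0 ((hc k).1 h1)) (hne k).symm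
  · have hc : ∀ k, (a (k + 1) < a (k + 2) ↔ ¬ a k < a (k + 1)) := fun k => by
      have := hP' k
      tauto
    have hc2 : ∀ m, (a (2 * m) < a (2 * m + 1) ↔ a 0 < a 1) := by
      intro m
      induction m with
      | zero => rfl
      | succ m ih =>
        have h1 := hc (2 * m)
        have h2 := hc (2 * m + 1)
        rw [show 2 * (m + 1) = 2 * m + 2 by ring]
        tauto
    obtain ⟨m, rfl⟩ := hq
    have h1 := hc (2 * m)
    have h2 := hc2 m
    rw [show 2 * m + 2 = 2 * m + 1 + 1 by ring, haq'] at h1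
    rw [haq] at h1 h2
    tauto

theorem iterate_eq_pow {M : Type w} [L.Structure M] (s : M ≃[L] M) (k : ℕ) (x : M) :
    (s : M → M)^[k] x = (s ^ k) x := by
  induction k with
  | zero => rfl
  | succ k ih => rw [Function.iterate_succ_apply', ih, pow_succ', mul_apply]

/-- In a Ramsey class whose automorphism groups have bounded order, an automorphism of odd order is
trivial. -/
theorem IsRamsey.eq_one_of_odd_order [L.IsRelational] (hK : IsFraisseClass K) (hR : IsRamsey K)
    {N : ℕ} (hN : ∀ A ∈ K, Nat.card (A ≃[L] A) ≤ N) {B : Bundled.{w} L.Structure} (hB : B ∈ K)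
    {s : B ≃[L] B} {q : ℕ} (hq : Odd q) (hs : s ^ q = 1) : s = 1 := by
  classical
  ext x
  have hfinB := hK.finite B hB
  let S : L.Substructure B := Substructure.closure L {x, s x}
  have hS (y : B) : y ∈ S ↔ y = x ∨ y = s x := by
    rw [Substructure.mem_closure_iff_of_isRelational]
    rfl
  let A : Bundled.{w} L.Structure := Bundled.of S
  have hA : A ∈ K := hK.hereditary B hB
    ⟨(Structure.FG.of_finite : Structure.FG L S), ⟨S.subtype⟩⟩
  -- The palette must be fixed before `D`; the uniform bound `N` lets `Fin N` index the
  -- automorphisms of `D`.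
  obtain ⟨D, hD, hmono⟩ := hR.exists_monochromatic hA hB (Fin N → Prop)
  have hfinD := hK.finite D hD
  have := Fintype.ofFinite (B ↪[L] D)
  obtain ⟨E, hE, i, hi⟩ := hK.exists_extension hB hD (Finset.univ : Finset (B ↪[L] D))
    id (fun j => j.comp s.toEmbedding)
  obtain ⟨g, hg, hgt⟩ := IsRamsey.exists_homogeneous_order hK hR hD hE
  obtain ⟨T, hT⟩ : ∃ T : Fin N → (D ≃[L] D), Function.Surjective T := by
    have h0 : 0 < Nat.card (D ≃[L] D) := Nat.card_pos
    refine ⟨Function.invFun fun t => Fin.castLE (hN D hD) (Finite.equivFin _ t),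
      Function.invFun_surjective ?_⟩
    exact (Fin.castLE_injective _).comp (Finite.equivFin _).injective
  -- The colour records which `T n` preserve, on the given substructure, the order pulled back along
  -- `i`.
  obtain ⟨j, hj⟩ := hmono fun R n => ∀ u ∈ R, ∀ v ∈ R,
    (g (i (T n u)) < g (i (T n v)) ↔ g (i u) < g (i v))
  obtain ⟨f, hf⟩ := hi j (Finset.mem_univ _)
  obtain ⟨t, ht⟩ := hgt f i
  obtain ⟨n, rfl⟩ := hT t
  have hf' (y : B) : f (j y) = i (j (s y)) := congrArg (fun e : B ↪[L] E => e y) hf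
  -- As `f ∘ j = i ∘ j ∘ s`, the order pulled back along `i ∘ T n` compares `j y` and `j (s y)` as
  -- `i` compares `j (s y)` and `j (s (s y))`. So the colour of the copy at `y = (s ^ k) x` decides
  -- whether the comparison persists.
  let e (k : ℕ) : A ↪[L] B := (s ^ k).toEmbedding.comp S.subtype
  have key (k : ℕ) :
      (∀ u ∈ (j.comp (e k)).toHom.range, ∀ v ∈ (j.comp (e k)).toHom.range,
        (g (i (T n u)) < g (i (T n v)) ↔ g (i u) < g (i v))) ↔
      (g (i (j (s ((s ^ k) x)))) < g (i (j (s (s ((s ^ k) x))))) ↔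
        g (i (j ((s ^ k) x))) < g (i (j (s ((s ^ k) x))))) := by
    have hcomm : (s ^ k) (s x) = s ((s ^ k) x) := by
      rw [← mul_apply, ← mul_apply, pow_mul_comm']
    have hr (P : D → Prop) : (∀ u ∈ (j.comp (e k)).toHom.range, P u) ↔
        P (j ((s ^ k) x)) ∧ P (j (s ((s ^ k) x))) := by
      constructor
      · intro h
        refine ⟨h _ ⟨⟨x, (hS x).2 (Or.inl rfl)⟩, rfl⟩, ?_⟩
        rw [← hcomm]
        exact h _ ⟨⟨s x, (hS _).2 (Or.inr rfl)⟩, rfl⟩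
      · rintro ⟨h1, h2⟩ _ ⟨⟨y, hy⟩, rfl⟩
        rcases (hS y).1 hy with rfl | rfl
        · exact h1
        · rw [← hcomm] at h2
          exact h2
    simp only [hr, ← ht, hf', lt_self_iff_false, true_and, and_true]
    constructor
    · exact fun h => h.1
    · intro h
      refine ⟨h, ?_⟩
      by_cases hx : s x = x
      · simp [hx, ← hcomm]
      · have h1 : (s ^ k) x ≠ s ((s ^ k) x) := by
          rw [← hcomm]
          exact fun h => hx ((s ^ k).injective h).symm
        have h2 := (hg.comp (i.injective.comp j.injective)).ne h1
        have h3 := (hg.comp (i.injective.comp (j.injective.comp s.injective))).ne h1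
        simp only [Function.comp_apply] at h2 h3
        omega
  refine apply_eq_of_odd_of_uniform_comparison
    (w := fun y => g (i (j y))) (hg.comp (i.injective.comp j.injective)) s.injective hq
    (by rw [iterate_eq_pow, hs, one_apply]) (P := ∀ u ∈ (j.comp (e 0)).toHom.range,
      ∀ v ∈ (j.comp (e 0)).toHom.range, (g (i (T n u)) < g (i (T n v)) ↔ g (i u) < g (i v)))
    fun k => ?_
  rw [iterate_eq_pow, ← key k]
  exact iff_of_eq (congrFun (hj (e 0) (e k)) n)

theorem IsRamsey.card_aut_eq_two_pow [L.IsRelational] (hK : IsFraisseClass K) (hR : IsRamsey K)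
    {N : ℕ} (hN : ∀ A ∈ K, Nat.card (A ≃[L] A) ≤ N) {B : Bundled.{w} L.Structure} (hB : B ∈ K) :
    ∃ m : ℕ, Nat.card (B ≃[L] B) = 2 ^ m := by
  have := hK.finite B hB
  refine ⟨_, Nat.eq_prime_pow_of_unique_prime_dvd Nat.card_pos.ne' fun {p} hp hdvd => ?_⟩
  by_contra hp2
  have := Fact.mk hp
  obtain ⟨s, hs⟩ := exists_prime_orderOf_dvd_card' p hdvd
  have h1 := IsRamsey.eq_one_of_odd_order hK hR hN hB (hp.odd_of_ne_two hp2)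
    (hs ▸ pow_orderOf_eq_one s)
  rw [h1, orderOf_one] at hs
  exact hp.one_lt.ne hs

end OddOrder

end FraisseRamsey

theorem theorem3p8 {L : FirstOrder.Language.{u, v}} [L.IsRelational] [Countable L.Symbols]
    (K : Set (CategoryTheory.Bundled.{w} L.Structure))
    (hK : FraisseRamsey.IsFraisseClass K) (hR : FraisseRamsey.IsRamsey K) :
    FraisseRamsey.embRamseyDegree K = ⊤ ∨
      ∃ m : ℕ, FraisseRamsey.embRamseyDegree K = 2 ^ m := by
  open FraisseRamsey in
  refine or_iff_not_imp_left.2 fun htop => ?_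
  obtain ⟨N, hN⟩ := ENat.ne_top_iff_exists.1 htop
  have hdeg (A) (hA : A ∈ K) : embRamseyDegreeOf K A = Nat.card (A ≃[L] A) :=
    have := hK.finite A hA
    hR.embRamseyDegreeOf_eq hA
  have hle (A) (hA : A ∈ K) : Nat.card (A ≃[L] A) ≤ N := by
    have : embRamseyDegreeOf K A ≤ embRamseyDegree K :=
      le_iSup₂ (f := fun A (_ : A ∈ K) => embRamseyDegreeOf K A) A hA
    rw [hdeg A hA, ← hN] at this
    exact_mod_cast this
  obtain ⟨A₀, hA₀, -⟩ := hK.unbounded 0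
  have hfin : ((fun A : CategoryTheory.Bundled.{w} L.Structure =>
      Nat.card (A ≃[L] A)) '' K).Finite :=
    (Set.finite_Iic N).subset (by rintro _ ⟨A, hA, rfl⟩; exact hle A hA)
  -- The largest of the bounded group orders is the supremum.
  obtain ⟨_, ⟨A, hA, rfl⟩, hmax⟩ := hfin.exists_maximal ⟨_, A₀, hA₀, rfl⟩
  obtain ⟨m, hm⟩ := IsRamsey.card_aut_eq_two_pow hK hR hle hA
  refine ⟨m, ?_⟩
  have hsup : embRamseyDegree K = Nat.card (A ≃[L] A) := by
    apply le_antisymm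
    · refine iSup₂_le fun B hB => ?_
      rw [hdeg B hB, Nat.cast_le]
      exact (le_total _ _).elim id (hmax ⟨B, hB, rfl⟩)
    · rw [← hdeg A hA]
      exact le_iSup₂ (f := fun A (_ : A ∈ K) => embRamseyDegreeOf K A) A hA
  rw [hsup, hm]
  push_cast
  rfl
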